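/- Let $k,n\ge 1$ and $d\ge 0$ be integers. Let $I_n^{[k]}$ be the $kn\times n$ matrix consisting of $k$ copies of the identity matrix $I_n$ stacked on top of each other, and let $$M=\begin{pmatrix}0 & I_n^{[k]}\\ (I_n^{[k]})^T & 0\end{pmatrix}.$$ Let $P_1,\dots,P_d$ be uniformly random $kn\times kn$ permutation matrices and $S_1,\dots,S_d$ uniformly random $n\times n$ permutation matrices, all $2d$ of them independent, and put $$B=\sum_{i=1}^d (P_i\oplus S_i)\,M\,(P_i\oplus S_i)^T,\qquad P\oplus S=\begin{pmatrix}P&0\\0&S\end{pmatrix}.$$ Then the expected characteristic polynomial $p(x)=\mathbb{E}\,\det(xI-B)$, where the expectation is over $P_1,\dots,P_d,S_1,\dots,S_d$, has degree $(k+1)n$ and is real-rooted (all its roots are real), and $$\mathbb{P}\bigl(\lambda_2(B)\le \mu_2(p)\bigr)>0,$$ where $\lambda_2(B)$ is the second largest eigenvalue of the real symmetric matrix $B$ and $\mu_2(p)$ is the second largest root of $p$, both counted with multiplicity. -/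

import Mathlib

open scoped Matrix

namespace ClawMatching

/-- The matrix `I_n^{[k]}`: `k` copies of the `n × n` identity matrix stacked on top of each other.
The row `(a, i)` is the `i`-th row of the `a`-th copy. -/
def stackedId (k n : ℕ) : Matrix (Fin k × Fin n) (Fin n) ℝ :=
  Matrix.of fun r j => if r.2 = j then 1 else 0

/-- The adjacency matrix `M` of the canonical `k`-claw matching, with off-diagonal blocks
`I_n^{[k]}` and its transpose. -/
def clawMatrix (k n : ℕ) : Matrix ((Fin k × Fin n) ⊕ Fin n) ((Fin k × Fin n) ⊕ Fin n) ℝ :=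
  Matrix.fromBlocks 0 (stackedId k n) (stackedId k n)ᵀ 0

/-- The block-diagonal matrix `P ⊕ S` of the permutation matrices of `σ` and `τ`. -/
def permSum {k n : ℕ} (σ : Equiv.Perm (Fin k × Fin n)) (τ : Equiv.Perm (Fin n)) :
    Matrix ((Fin k × Fin n) ⊕ Fin n) ((Fin k × Fin n) ⊕ Fin n) ℝ :=
  Matrix.fromBlocks (σ.permMatrix ℝ) 0 0 (τ.permMatrix ℝ)

/-- The sample space: `d` pairs of permutations, of the `k * n` row indices and of the `n` column
indices. -/
abbrev Sample (k n d : ℕ) : Type :=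
  Fin d → Equiv.Perm (Fin k × Fin n) × Equiv.Perm (Fin n)

/-- The joint law of independent uniform `P_1, …, P_d, S_1, …, S_d`: the uniform distribution on
the finite product of the groups they range over. -/
noncomputable def law (k n d : ℕ) : PMF (Sample k n d) :=
  PMF.uniformOfFintype (Sample k n d)

/-- The random matrix `B = ∑ i, (P_i ⊕ S_i) M (P_i ⊕ S_i)ᵀ`. -/
def unionMatrix {k n d : ℕ} (ω : Sample k n d) :
    Matrix ((Fin k × Fin n) ⊕ Fin n) ((Fin k × Fin n) ⊕ Fin n) ℝ :=
  ∑ i, permSum (ω i).1 (ω i).2 * clawMatrix k n * (permSum (ω i).1 (ω i).2)ᵀ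

/-- The expectation of a polynomial-valued random variable on a finite probability space. -/
noncomputable def expectedPoly {Ω : Type*} [Fintype Ω] (p : PMF Ω) (f : Ω → Polynomial ℝ) :
    Polynomial ℝ :=
  ∑ ω, (p ω).toReal • f ω

/-- The expected characteristic polynomial of `B`. -/
noncomputable def expectedCharpoly (k n d : ℕ) : Polynomial ℝ :=
  expectedPoly (law k n d) fun ω => (unionMatrix ω).charpoly

theorem clawMatrix_isHermitian (k n : ℕ) : (clawMatrix k n).IsHermitian := by
  simp [Matrix.IsHermitian, clawMatrix, Matrix.fromBlocks_transpose,
    Matrix.conjTranspose_eq_transpose_of_trivial]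

theorem unionMatrix_isHermitian {k n d : ℕ} (ω : Sample k n d) :
    (unionMatrix ω).IsHermitian := by
  have hM := clawMatrix_isHermitian k n
  simp only [Matrix.IsHermitian, Matrix.conjTranspose_eq_transpose_of_trivial] at hM ⊢
  simp [unionMatrix, Matrix.transpose_sum, Matrix.transpose_mul, hM, Matrix.mul_assoc]

theorem one_lt_card_index {k n : ℕ} (hk : 0 < k) (hn : 0 < n) :
    1 < Fintype.card ((Fin k × Fin n) ⊕ Fin n) := by
  have := Nat.mul_pos hk hn
  simp only [Fintype.card_sum, Fintype.card_prod, Fintype.card_fin]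
  omega

/-- The second largest eigenvalue `λ₂(A)`, counted with multiplicity, of a Hermitian matrix of size
at least two (`eigenvalues₀` lists the eigenvalues in decreasing order). -/
noncomputable def lambdaTwo {ι : Type*} [Fintype ι] [DecidableEq ι] {A : Matrix ι ι ℝ}
    (hA : A.IsHermitian) (hι : 1 < Fintype.card ι) : ℝ :=
  hA.eigenvalues₀ ⟨1, hι⟩

/-- The second largest root `μ₂(p)`, counted with multiplicity, of a real polynomial (the default
value `0` is used only if there are fewer than two real roots). -/
noncomputable def muTwo (p : Polynomial ℝ) : ℝ :=
  (p.roots.sort (· ≥ ·)).getD 1 0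

end ClawMatching

/-!
The argument is the method of interlacing families, run over the group of simultaneous permutations
of the `d` copies of the claw matrix.

*Swaps.* A uniform permutation of `m + 1` points is a uniform permutation of `m` of them, then a
transposition performed with probability `m / (m + 1)`, then again a uniform permutation of `m`
points (`sum_perm_option`). So averaging over all samples is a composition of averages
`p ↦ (1 - θ) p(A) + θ p(s A s)`, each over one random transposition `s` of one of the matrices, and
it suffices to find a property of maps `A ↦ p(A)` from families of matrices to polynomials which
holds for `A ↦ charpoly (∑ j, A j)`, survives each such average, and contains the conclusion. That
property is `IsAdmissible`; its survival is `IsAdmissible.lazyAverage_swap`.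

*Real-rootedness.* For symmetric `A` and a transposition `s` there are vectors `u`, `v` with
`s A s + v vᵀ / 2 = A + u uᵀ / 2`. Hence `p(A)` and `p(s A s)` are both joined by a pencil of
real-rooted polynomials `r + t q` to one and the same polynomial `r = p(A + u uᵀ / 2)`, where `q` is
zero or, by comparison of traces, has a positive coefficient just below the top degree. In the second
case `q / r` maps the upper half-plane into the lower one (`im_div_neg_of_splits_pencil`). Having
nonpositive imaginary part is a convex condition on `q / r`, so all convex combinations of `p(A)` and
`p(s A s)` are real-rooted (`splits_convex_comb_of_splits_pencils`).

*Second roots.* For a monic real-rooted polynomial the sum of the arguments of `z - a` over its roots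
`a` is a continuous branch of its argument on the upper half-plane, and near a real `x` it counts the
roots beyond `x`. When all convex combinations of `f` and `g` are real-rooted, `g / f` avoids the
negative axis, so the phase of a convex combination is pointwise at least the smaller of the phases
of `f` and `g`, and therefore so is the number of its roots beyond any `x`
(`muTwo_le_muTwo_convex_comb`). Thus one of the two polynomials has a second root no larger than that
of the average, and undoing the averages one at a time leads to a single sample. No interlacing
polynomial has to be written down, and multiple roots need no separate treatment.
-/

open Polynomial Filter Topology

namespace ClawMatching

/-! ### Phases of real-rooted polynomials -/

/-- The phase of a real polynomial at `z`: the sum, over the real roots `a` with multiplicity, of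
`arg (z - a)`. For a monic real-rooted polynomial and `z` in the upper half-plane this is the
continuous branch of the argument of the value at `z`. -/
noncomputable def rootPhase (f : ℝ[X]) (z : ℂ) : ℝ :=
  (f.roots.map fun a : ℝ => (z - a).arg).sum

lemma aeval_eq_norm_mul_exp_rootPhase {f : ℝ[X]} (hf : f.Monic) (hs : f.Splits) (z : ℂ) :
    aeval z f = ‖aeval z f‖ * Complex.exp (rootPhase f z * Complex.I) := by
  have h : aeval z f = (f.roots.map fun a : ℝ => z - (a : ℂ)).prod := by
    conv_lhs => rw [hs.eq_prod_roots_of_monic hf]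
    rw [map_multiset_prod, Multiset.map_map]
    simp
  rw [h, rootPhase]
  induction f.roots using Multiset.induction_on with
  | empty => simp
  | cons a s ih =>
    simp only [Multiset.map_cons, Multiset.prod_cons, Multiset.sum_cons, norm_mul,
      Complex.ofReal_mul, Complex.ofReal_add, add_mul, Complex.exp_add]
    conv_lhs => rw [ih, ← Complex.norm_mul_exp_arg_mul_I (z - a)]
    ring

lemma aeval_ne_zero_of_im_pos {f : ℝ[X]} (hf : f ≠ 0) (hs : f.Splits) {z : ℂ} (hz : 0 < z.im) :
    aeval z f ≠ 0 := by
  rw [hs.eq_prod_roots, map_mul, map_multiset_prod, Multiset.map_map]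
  simp only [aeval_C, ne_eq, mul_eq_zero, not_or]
  refine ⟨by simpa using hf, ?_⟩
  rw [Multiset.prod_eq_zero_iff]
  simp only [Multiset.mem_map, Function.comp_apply, map_sub, aeval_X, aeval_C, not_exists, not_and]
  intro a _ h
  have := congrArg Complex.im h
  simp at this
  exact hz.ne' this

lemma splits_of_aeval_ne_zero {f : ℝ[X]} (h : ∀ z : ℂ, 0 < z.im → aeval z f ≠ 0) : f.Splits := by
  refine Splits.of_splits_map_of_injective (i := algebraMap ℝ ℂ)
    (algebraMap ℝ ℂ).injective (IsAlgClosed.splits _) fun a ha => ?_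
  have h0 : aeval a f = 0 := by
    have := (mem_roots'.1 ha).2
    rwa [IsRoot.def, eval_map_algebraMap] at this
  have him : a.im = 0 := by
    rcases lt_trichotomy a.im 0 with hlt | heq | hgt
    · exfalso
      refine h (starRingEnd ℂ a) (by simpa using hlt) ?_
      have := aeval_conj f a
      rw [this, h0, map_zero]
    · exact heq
    · exact (h a hgt h0).elim
  exact ⟨a.re, Complex.ext (by simp) (by simp [him])⟩

lemma sub_ofReal_mem_slitPlane {z : ℂ} (hz : 0 < z.im) (a : ℝ) : z - a ∈ Complex.slitPlane :=
  Or.inr (by simpa using hz.ne')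

lemma continuousOn_rootPhase (f : ℝ[X]) : ContinuousOn (rootPhase f) {z | 0 < z.im} := by
  intro z hz
  apply ContinuousAt.continuousWithinAt
  refine tendsto_multiset_sum (f := fun (a : ℝ) (z : ℂ) => (z - a).arg) _ fun a _ => ?_
  exact (Complex.continuousAt_arg (sub_ofReal_mem_slitPlane hz a)).comp
    (f := fun w : ℂ => w - (a : ℂ)) (continuousAt_id.sub continuousAt_const)

lemma isPreconnected_upperHalfPlane : IsPreconnected {z : ℂ | 0 < z.im} :=
  (convex_halfSpace_im_gt 0).isPreconnected

lemma tendsto_rootPhase_atTop {f : ℝ[X]} (hs : f.Splits) :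
    Tendsto (fun y : ℝ => rootPhase f (y * Complex.I)) atTop
      (𝓝 (f.natDegree * (Real.pi / 2))) := by
  have key : ∀ a : ℝ, Tendsto (fun y : ℝ => (y * Complex.I - a).arg) atTop (𝓝 (Real.pi / 2)) := by
    intro a
    have h1 : Tendsto (fun y : ℝ => Complex.I - ((y⁻¹ * a : ℝ) : ℂ)) atTop (𝓝 Complex.I) := by
      have : Tendsto (fun y : ℝ => y⁻¹ * a) atTop (𝓝 0) := by
        simpa using tendsto_inv_atTop_zero.mul_const a
      simpa using tendsto_const_nhds.sub
        ((Complex.continuous_ofReal.tendsto 0).comp this)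
    have h2 := (Complex.continuousAt_arg (x := Complex.I) (Or.inr (by simp))).tendsto.comp h1
    rw [Complex.arg_I] at h2
    refine h2.congr' ?_
    filter_upwards [eventually_gt_atTop 0] with y hy
    have : (y : ℂ) ≠ 0 := by exact_mod_cast hy.ne'
    simp only [Function.comp_apply]
    rw [← Complex.arg_real_mul _ hy]
    congr 1
    push_cast
    field_simp
  have := tendsto_multiset_sum (f := fun (a y : ℝ) => (y * Complex.I - a : ℂ).arg) f.roots
    fun a _ => key a
  simpa [rootPhase, hs.natDegree_eq_card_roots] using this

/-- If the quotient of two monic real-rooted polynomials of the same degree avoids the negative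
real axis on the upper half-plane, then its argument is the difference of the two phases. The two
sides differ by a continuous function with values in `2πℤ`, hence by a constant, which is seen to
vanish far up on the imaginary axis. -/
lemma rootPhase_sub_rootPhase {f r : ℝ[X]} (hf : f.Monic) (hr : r.Monic) (hfs : f.Splits)
    (hrs : r.Splits) (hdeg : f.natDegree = r.natDegree)
    (hslit : ∀ z : ℂ, 0 < z.im → aeval z f / aeval z r ∈ Complex.slitPlane)
    {z : ℂ} (hz : 0 < z.im) :
    rootPhase f z - rootPhase r z = (aeval z f / aeval z r).arg := by
  set E : ℂ → ℝ := fun w => rootPhase f w - rootPhase r w - (aeval w f / aeval w r).arg with hE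
  have hcont : ContinuousOn E {z | 0 < z.im} := by
    refine ((continuousOn_rootPhase f).sub (continuousOn_rootPhase r)).sub fun w hw => ?_
    refine ((Complex.continuousAt_arg (hslit w hw)).comp
      (f := fun w : ℂ => aeval w f / aeval w r) ?_).continuousWithinAt
    exact (f.continuous_aeval.continuousAt).div r.continuous_aeval.continuousAt
      (aeval_ne_zero_of_im_pos hr.ne_zero hrs hw)
  have hmaps : Set.MapsTo E {z | 0 < z.im} (AddSubgroup.zmultiples (2 * Real.pi) : Set ℝ) := by
    intro w hw
    have hw' : 0 < w.im := hw
    have hf0 := aeval_ne_zero_of_im_pos hf.ne_zero hfs hw'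
    have hr0 := aeval_ne_zero_of_im_pos hr.ne_zero hrs hw'
    have h1 := aeval_eq_norm_mul_exp_rootPhase hf hfs w
    have h2 := aeval_eq_norm_mul_exp_rootPhase hr hrs w
    have h3 := Complex.norm_mul_exp_arg_mul_I (aeval w f / aeval w r)
    have hnf : (‖aeval w f‖ : ℂ) ≠ 0 := by simpa using hf0
    have hnr : (‖aeval w r‖ : ℂ) ≠ 0 := by simpa using hr0
    have h4 : Complex.exp (E w * Complex.I) = 1 := by
      simp only [hE, Complex.ofReal_sub, sub_mul, Complex.exp_sub]
      rw [norm_div, Complex.ofReal_div] at h3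
      have e1 : Complex.exp (rootPhase f w * Complex.I) = aeval w f / ‖aeval w f‖ := by
        rw [eq_div_iff hnf, mul_comm]; exact h1.symm
      have e2 : Complex.exp (rootPhase r w * Complex.I) = aeval w r / ‖aeval w r‖ := by
        rw [eq_div_iff hnr, mul_comm]; exact h2.symm
      have e3 : Complex.exp ((aeval w f / aeval w r).arg * Complex.I)
          = aeval w f / aeval w r / (‖aeval w f‖ / ‖aeval w r‖) := by
        rw [eq_div_iff (div_ne_zero hnf hnr), mul_comm]; exact h3
      rw [e1, e2, e3]
      field_simp
    obtain ⟨n, hn⟩ := Complex.exp_eq_one_iff.1 h4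
    refine ⟨n, ?_⟩
    have h5 : ((E w : ℝ) : ℂ) = ((n * (2 * Real.pi) : ℝ) : ℂ) := by
      have := mul_right_cancel₀ Complex.I_ne_zero
        (show (E w : ℂ) * Complex.I = (n * (2 * Real.pi)) * Complex.I by rw [hn]; ring)
      rw [this]; push_cast; ring
    simpa using (Complex.ofReal_injective h5).symm
  obtain ⟨y, hy, hEy⟩ := isPreconnected_upperHalfPlane.eqOn_const_of_mapsTo
    (isDiscrete_iff_discreteTopology.2 (inferInstanceAs
      (DiscreteTopology (AddSubgroup.zmultiples (2 * Real.pi))))) hcont hmaps ⟨0, zero_mem _⟩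
  have hsmall : ∃ t : ℝ, 0 < t ∧
      |rootPhase f (t * Complex.I) - rootPhase r (t * Complex.I)| < 1 := by
    have h := (tendsto_rootPhase_atTop hfs).sub (tendsto_rootPhase_atTop hrs)
    rw [hdeg, sub_self] at h
    have h1 := h.abs.eventually_lt_const (show |(0 : ℝ)| < 1 by simp)
    exact ((eventually_gt_atTop (0 : ℝ)).and h1).exists
  obtain ⟨t, ht, htl⟩ := hsmall
  have hEt : E (t * Complex.I) = y := hEy (by simpa using ht)
  obtain ⟨n, hn⟩ := hy
  have hy0 : |y| < 2 * Real.pi := by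
    rw [← hEt]
    have h1 := abs_sub (rootPhase f (t * Complex.I) - rootPhase r (t * Complex.I))
      ((aeval (t * Complex.I : ℂ) f / aeval (t * Complex.I : ℂ) r).arg)
    have h2 := Complex.abs_arg_le_pi (aeval (t * Complex.I : ℂ) f / aeval (t * Complex.I : ℂ) r)
    have h3 := Real.pi_gt_three
    simp only [hE]
    linarith
  have hn0 : n = 0 := by
    simp only [zsmul_eq_mul] at hn
    rw [← hn, abs_mul, abs_of_pos Real.two_pi_pos] at hy0
    have h1 : |(n : ℝ)| < 1 := by
      by_contra hcon
      nlinarith [Real.two_pi_pos]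
    exact Int.abs_lt_one_iff.1 (by exact_mod_cast h1)
  have : E z = y := hEy hz
  rw [← hn, hn0] at this
  simp only [hE, zero_smul] at this
  linarith

/-- Approaching a non-root `x` of the real axis from above, the phase tends to `π` times the number
of roots greater than `x`. -/
lemma tendsto_rootPhase_nhdsGT {f : ℝ[X]} {x : ℝ} (hx : x ∉ f.roots) :
    Tendsto (fun ε : ℝ => rootPhase f (x + ε * Complex.I)) (𝓝[>] 0)
      (𝓝 (Real.pi * (f.roots.filter (x < ·)).card)) := by
  have key : ∀ a ∈ f.roots, Tendsto (fun ε : ℝ => (x + ε * Complex.I - a : ℂ).arg) (𝓝[>] 0)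
      (𝓝 (if x < a then Real.pi else 0)) := by
    intro a ha
    have hne : x ≠ a := fun h => hx (h ▸ ha)
    have hlim : Tendsto (fun ε : ℝ => (x + ε * Complex.I - a : ℂ)) (𝓝[>] 0)
        (𝓝 ((x - a : ℝ) : ℂ)) := by
      have : Continuous (fun ε : ℝ => (x + ε * Complex.I - a : ℂ)) := by fun_prop
      have := this.tendsto 0
      simp only [Complex.ofReal_zero, zero_mul, add_zero] at this
      rw [Complex.ofReal_sub]
      exact this.mono_left nhdsWithin_le_nhds
    split_ifs with hxa
    · refine (Complex.tendsto_arg_nhdsWithin_im_nonneg_of_re_neg_of_im_zero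
        (z := ((x - a : ℝ) : ℂ)) (by simpa using hxa) (by simp)).comp ?_
      refine tendsto_nhdsWithin_iff.2 ⟨hlim, ?_⟩
      filter_upwards [self_mem_nhdsWithin] with ε hε
      simpa using (Set.mem_Ioi.1 hε).le
    · have hpos : 0 < x - a := sub_pos.2 (lt_of_le_of_ne (not_lt.1 hxa) hne.symm)
      have := (Complex.continuousAt_arg (x := ((x - a : ℝ) : ℂ))
        (Or.inl (by rwa [Complex.ofReal_re]))).tendsto.comp hlim
      rwa [Complex.arg_ofReal_of_nonneg hpos.le] at this
  have := tendsto_multiset_sum (f := fun (a ε : ℝ) => (x + ε * Complex.I - a : ℂ).arg) f.roots key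
  have hsum : (f.roots.map fun a => if x < a then Real.pi else 0).sum
      = Real.pi * (f.roots.filter (x < ·)).card := by
    induction f.roots using Multiset.induction_on with
    | empty => simp
    | cons a s ih =>
      rw [Multiset.map_cons, Multiset.sum_cons, ih]
      by_cases h : x < a
      · simp [h, mul_add, add_comm]
      · simp [h]
  rwa [hsum] at this

/-! ### Comparing the second largest roots -/

lemma lt_muTwo_iff {f : ℝ[X]} (h2 : 2 ≤ f.roots.card) (c : ℝ) :
    c < muTwo f ↔ 2 ≤ (f.roots.filter (c < ·)).card := by
  have hsort : (f.roots.sort (· ≥ ·)).Pairwise (· ≥ ·) := Multiset.pairwise_sort _ _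
  have hcoe : ((f.roots.sort (· ≥ ·) : List ℝ) : Multiset ℝ) = f.roots := Multiset.sort_eq _ _
  have hcard : 2 ≤ (f.roots.sort (· ≥ ·)).length := by rwa [Multiset.length_sort]
  have hfil : (f.roots.filter (c < ·)).card
      = ((f.roots.sort (· ≥ ·)).filter (c < ·)).length := by
    conv_lhs => rw [← hcoe]
    rw [Multiset.filter_coe, Multiset.coe_card]
  rw [muTwo, hfil]
  clear hfil hcoe h2
  generalize f.roots.sort (· ≥ ·) = l at *
  match l, hcard with
  | a :: b :: t, _ =>
    simp only [List.pairwise_cons] at hsort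
    obtain ⟨hab, hbt, -⟩ := hsort
    have hba : b ≤ a := hab b (by simp)
    simp only [List.getD_cons_succ, List.getD_cons_zero]
    constructor
    · intro h
      simp [h, h.trans_le hba]
    · intro h
      by_contra hc
      rw [not_lt] at hc
      have ht : t.filter (fun y => decide (c < y)) = [] := by
        rw [List.filter_eq_nil_iff]
        intro y hy
        simpa using (hbt y hy).le.trans hc
      rw [List.filter_cons, List.filter_cons, ht] at h
      have hbf : ¬ (decide (c < b) = true) := by simpa using hc
      rw [if_neg hbf] at h
      split_ifs at h <;> simp at h

lemma aeval_convex_comb (f g : ℝ[X]) (θ : ℝ) (z : ℂ) :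
    aeval z ((1 - θ) • f + θ • g) = (1 - θ) * aeval z f + θ * aeval z g := by
  simp

lemma natDegree_convex_comb {f g : ℝ[X]} (hf : f.Monic) (hg : g.Monic)
    (hdeg : f.natDegree = g.natDegree) (θ : ℝ) :
    ((1 - θ) • f + θ • g).Monic ∧ ((1 - θ) • f + θ • g).natDegree = f.natDegree := by
  have hle : ((1 - θ) • f + θ • g).natDegree ≤ f.natDegree :=
    (natDegree_add_le _ _).trans (max_le (natDegree_smul_le _ _)
      ((natDegree_smul_le _ _).trans hdeg.ge))
  have hc : ((1 - θ) • f + θ • g).coeff f.natDegree = 1 := by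
    have h1 := hf.coeff_natDegree
    have h2 := hg.coeff_natDegree
    rw [← hdeg] at h2
    simp [h1, h2]
  have hd : ((1 - θ) • f + θ • g).natDegree = f.natDegree :=
    le_antisymm hle (le_natDegree_of_ne_zero (by rw [hc]; exact one_ne_zero))
  exact ⟨by rw [Monic, leadingCoeff, hd, hc], hd⟩

section ConvexCombination

variable {f g : ℝ[X]} (hf : f.Monic) (hg : g.Monic) (hdeg : f.natDegree = g.natDegree)
  (hs : ∀ θ : ℝ, 0 ≤ θ → θ ≤ 1 → ((1 - θ) • f + θ • g).Splits)

include hf hg hdeg hs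

lemma div_mem_slitPlane_of_splits_convex_comb {z : ℂ} (hz : 0 < z.im) :
    aeval z g / aeval z f ∈ Complex.slitPlane := by
  have hf0 : aeval z f ≠ 0 :=
    aeval_ne_zero_of_im_pos hf.ne_zero (by simpa using hs 0 le_rfl zero_le_one) hz
  by_contra hcon
  rw [Complex.mem_slitPlane_iff, not_or, not_lt, not_not] at hcon
  set w := aeval z g / aeval z f with hw
  have hgw : aeval z g = w * aeval z f := by rw [hw, div_mul_cancel₀ _ hf0]
  have hwre : w = ((w.re : ℝ) : ℂ) := Complex.ext (by simp) (by simp [hcon.2])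
  have hpos : 0 < 1 - w.re := by linarith [hcon.1]
  have hθ := hs (1 / (1 - w.re)) (by positivity) (by rw [div_le_one hpos]; linarith [hcon.1])
  refine aeval_ne_zero_of_im_pos (natDegree_convex_comb hf hg hdeg _).1.ne_zero hθ hz ?_
  have hne : (1 - (w.re : ℂ)) ≠ 0 := by exact_mod_cast hpos.ne'
  generalize w.re = x at *
  rw [aeval_convex_comb, hgw, hwre]
  push_cast
  field_simp
  ring

/-- Where the phase of `g` is at least that of `f`, so is the phase of a convex combination. -/
lemma rootPhase_le_rootPhase_convex_comb {θ : ℝ} (h0 : 0 ≤ θ) (h1 : θ ≤ 1) {z : ℂ}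
    (hz : 0 < z.im) (hfg : rootPhase f z ≤ rootPhase g z) :
    rootPhase f z ≤ rootPhase ((1 - θ) • f + θ • g) z := by
  have hfs : f.Splits := by simpa using hs 0 le_rfl zero_le_one
  have hgs : g.Splits := by simpa using hs 1 zero_le_one le_rfl
  have hp := natDegree_convex_comb hf hg hdeg θ
  have hdiv : ∀ w : ℂ, 0 < w.im → aeval w ((1 - θ) • f + θ • g) / aeval w f
      = ((1 - θ : ℝ) : ℂ) + (θ : ℂ) * (aeval w g / aeval w f) := by
    intro w hw
    have := aeval_ne_zero_of_im_pos hf.ne_zero hfs hw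
    rw [aeval_convex_comb]
    field_simp
    push_cast
    ring
  have e1 := rootPhase_sub_rootPhase hg hf hgs hfs hdeg.symm
    (fun w hw => div_mem_slitPlane_of_splits_convex_comb hf hg hdeg hs hw) hz
  have e2 := rootPhase_sub_rootPhase hp.1 hf (hs θ h0 h1) hfs hp.2 (fun w hw => by
    rw [hdiv w hw]
    have hw := div_mem_slitPlane_of_splits_convex_comb hf hg hdeg hs hw
    rcases h0.eq_or_lt with rfl | hθ
    · simp
    · rw [Complex.mem_slitPlane_iff] at hw ⊢
      simp only [Complex.add_re, Complex.ofReal_re, Complex.re_ofReal_mul, Complex.add_im,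
        Complex.ofReal_im, Complex.im_ofReal_mul, zero_add]
      rcases hw with hw | hw
      · left; nlinarith
      · right; exact mul_ne_zero hθ.ne' hw) hz
  rw [← sub_nonneg, e2, hdiv z hz, Complex.arg_nonneg_iff]
  rw [← sub_nonneg, e1, Complex.arg_nonneg_iff] at hfg
  simpa using mul_nonneg h0 hfg

/-- If all convex combinations of `f` and `g` are real-rooted, the second largest root of each of
them is at least that of `f` or that of `g`. -/
lemma muTwo_le_muTwo_convex_comb (h2 : 2 ≤ f.natDegree) {θ : ℝ} (h0 : 0 ≤ θ) (h1 : θ ≤ 1) :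
    muTwo f ≤ muTwo ((1 - θ) • f + θ • g) ∨ muTwo g ≤ muTwo ((1 - θ) • f + θ • g) := by
  have hfs : f.Splits := by simpa using hs 0 le_rfl zero_le_one
  have hgs : g.Splits := by simpa using hs 1 zero_le_one le_rfl
  have hp := natDegree_convex_comb hf hg hdeg θ
  have hps := hs θ h0 h1
  set p := (1 - θ) • f + θ • g with hpdef
  by_contra! hcon
  have hcf := hfs.natDegree_eq_card_roots
  have hcg := hgs.natDegree_eq_card_roots
  have hcp := hps.natDegree_eq_card_roots
  obtain ⟨x, hx, hxn⟩ := ((Set.Ioo_infinite (lt_min hcon.1 hcon.2)).sdiff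
    (f.roots + g.roots + p.roots).toFinset.finite_toSet).nonempty
  simp only [Finset.mem_coe, Multiset.mem_toFinset, Multiset.mem_add, not_or] at hxn
  obtain ⟨⟨hxf, hxg⟩, hxp⟩ := hxn
  have hnf := (lt_muTwo_iff (by omega) x).1 (hx.2.trans_le (min_le_left _ _))
  have hng := (lt_muTwo_iff (by omega) x).1 (hx.2.trans_le (min_le_right _ _))
  have hnp : ¬ 2 ≤ (p.roots.filter (x < ·)).card := by
    rw [← lt_muTwo_iff (by omega) x]
    exact not_lt.2 hx.1.le
  have hphase : ∀ z : ℂ, 0 < z.im → min (rootPhase f z) (rootPhase g z) ≤ rootPhase p z := by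
    intro z hz
    rcases le_total (rootPhase f z) (rootPhase g z) with h | h
    · exact (min_le_left _ _).trans
        (rootPhase_le_rootPhase_convex_comb hf hg hdeg hs h0 h1 hz h)
    · have hs' : ∀ η : ℝ, 0 ≤ η → η ≤ 1 → ((1 - η) • g + η • f).Splits := fun η hη0 hη1 => by
        simpa [add_comm] using hs (1 - η) (by linarith) (by linarith)
      have := rootPhase_le_rootPhase_convex_comb hg hf hdeg.symm hs' (θ := 1 - θ)
        (by linarith) (by linarith) hz h
      rw [sub_sub_cancel, add_comm] at this
      exact (min_le_right _ _).trans this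
  have hlim := le_of_tendsto_of_tendsto
    ((tendsto_rootPhase_nhdsGT hxf).min (tendsto_rootPhase_nhdsGT hxg))
    (tendsto_rootPhase_nhdsGT hxp) (by
      filter_upwards [self_mem_nhdsWithin] with ε hε
      exact hphase _ (by simpa using hε))
  have hpi := Real.pi_pos
  rw [← mul_min_of_nonneg _ _ hpi.le] at hlim
  have hlim := le_of_mul_le_mul_left hlim hpi
  rw [min_le_iff, Nat.cast_le, Nat.cast_le] at hlim
  omega

end ConvexCombination

/-! ### Pencils of real-rooted polynomials -/

/-- If every member of the pencil `r + t q` is real-rooted and `q` has degree exactly one less than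
`r`, with positive leading coefficient, then `q / r` maps the upper half-plane to the lower one. By
hypothesis `q / r` takes no nonzero real value there, so by the open mapping theorem no real value
at all, and its imaginary part has a constant sign, which can be read off near `∞`. -/
lemma im_div_neg_of_splits_pencil {r q : ℝ[X]} (hr : r.Monic) (hdeg : q.natDegree + 1 = r.natDegree)
    (hq : 0 < q.leadingCoeff) (hs : ∀ t : ℝ, (r + C t * q).Splits) {z : ℂ} (hz : 0 < z.im) :
    (aeval z q / aeval z r).im < 0 := by
  have hrs : r.Splits := by simpa using hs 0
  have hr0 : ∀ w : ℂ, 0 < w.im → aeval w r ≠ 0 := fun w hw =>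
    aeval_ne_zero_of_im_pos hr.ne_zero hrs hw
  set g : ℂ → ℂ := fun w => aeval w q / aeval w r with hg
  have hreal : ∀ w : ℂ, 0 < w.im → (g w).im = 0 → g w = 0 := by
    intro w hw him
    by_contra hne
    have hgre : g w = ((g w).re : ℂ) := Complex.ext (by simp) (by simp [him])
    have hre : ((g w).re : ℂ) ≠ 0 := by rwa [← hgre]
    have hnz : r + C (-(g w).re⁻¹) * q ≠ 0 := by
      intro h
      have := congrArg (fun p => p.coeff r.natDegree) h
      rw [coeff_add, coeff_C_mul, coeff_eq_zero_of_natDegree_lt (p := q) (by omega),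
        hr.coeff_natDegree] at this
      simp at this
    refine aeval_ne_zero_of_im_pos hnz (hs _) hw ?_
    have hqg : aeval w q = ((g w).re : ℂ) * aeval w r := by
      rw [← hgre, hg]
      exact (div_mul_cancel₀ _ (hr0 w hw)).symm
    rw [map_add, map_mul, aeval_C, hqg]
    simp only [Complex.coe_algebraMap, Complex.ofReal_neg, Complex.ofReal_inv]
    field_simp
    simp
  have han : AnalyticOnNhd ℂ g {w | 0 < w.im} :=
    (AnalyticOnNhd.aeval_polynomial analyticOnNhd_id q).div
      (AnalyticOnNhd.aeval_polynomial analyticOnNhd_id r) hr0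
  have hcont : ContinuousOn g {w | 0 < w.im} := han.continuousOn
  have hneg : ∃ w : ℂ, 0 < w.im ∧ (g w).im < 0 := by
    -- In terms of `s = 1 / y`, the value of `q / r` at `I y` is `-I s h(s)` with `h` continuous at
    -- `0` and `h(0)` the leading coefficient of `q`.
    set h : ℝ → ℂ := fun s => aeval (-(s * Complex.I)) q.reverse / aeval (-(s * Complex.I)) r.reverse
      with hh
    have hc : ContinuousAt h 0 := by
      refine ContinuousAt.div ?_ ?_ ?_
      · exact (q.reverse.continuous_aeval.comp (by fun_prop : Continuous fun s : ℝ =>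
          -((s : ℂ) * Complex.I))).continuousAt
      · exact (r.reverse.continuous_aeval.comp (by fun_prop : Continuous fun s : ℝ =>
          -((s : ℂ) * Complex.I))).continuousAt
      · simp [← coeff_zero_eq_aeval_zero', hr.leadingCoeff]
    have h0 : h 0 = (q.leadingCoeff : ℂ) := by
      simp [hh, ← coeff_zero_eq_aeval_zero', hr.leadingCoeff]
    have hre : Tendsto (fun s => (h s).re) (𝓝[>] 0) (𝓝 q.leadingCoeff) := by
      have := (Complex.continuous_re.continuousAt.comp hc).tendsto
      simp only [Function.comp_apply, h0, Complex.ofReal_re] at this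
      exact this.mono_left nhdsWithin_le_nhds
    obtain ⟨s, hs0, hsp⟩ := (eventually_mem_nhdsWithin.and (hre.eventually_const_lt hq)).exists
    replace hs0 : 0 < s := hs0
    have hsc : (s : ℂ) ≠ 0 := by exact_mod_cast hs0.ne'
    refine ⟨(s : ℂ)⁻¹ * Complex.I, by
      rw [← Complex.ofReal_inv]; simpa using hs0, ?_⟩
    have hx : ((s : ℂ)⁻¹ * Complex.I) ≠ 0 := mul_ne_zero (inv_ne_zero hsc) Complex.I_ne_zero
    let _ := invertibleOfNonzero hx
    have hinv : ⅟((s : ℂ)⁻¹ * Complex.I) = -(s * Complex.I) := by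
      rw [invOf_eq_inv, mul_inv, inv_inv, Complex.inv_I, mul_neg]
    have e1 := eval₂_reverse_mul_pow (algebraMap ℝ ℂ) ((s : ℂ)⁻¹ * Complex.I) q
    have e2 := eval₂_reverse_mul_pow (algebraMap ℝ ℂ) ((s : ℂ)⁻¹ * Complex.I) r
    rw [hinv, ← aeval_def, ← aeval_def] at e1 e2
    have hval : g ((s : ℂ)⁻¹ * Complex.I) = -(s * Complex.I) * h s := by
      simp only [hg, hh]
      rw [← e1, ← e2, ← hdeg, pow_succ, ← hinv, invOf_eq_inv]
      have := pow_ne_zero q.natDegree hx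
      rw [mul_div_mul_comm, div_mul_cancel_left₀ this, mul_comm]
    rw [hval]
    have : (-((s : ℂ) * Complex.I) * h s).im = -(s * (h s).re) := by
      simp [Complex.mul_im]
    rw [this]
    nlinarith
  obtain ⟨w₀, hw₀, hw₀n⟩ := hneg
  rcases han.is_constant_or_isOpen isPreconnected_upperHalfPlane with ⟨c, hc⟩ | hopen
  · show (g z).im < 0
    rw [hc z hz, ← hc w₀ hw₀]
    exact hw₀n
  · have hne : ∀ w : ℂ, 0 < w.im → (g w).im ≠ 0 := by
      intro w hw him
      have hg0 := hreal w hw him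
      have hnhds : g '' {w | 0 < w.im} ∈ 𝓝 (0 : ℂ) :=
        (hopen _ subset_rfl (isOpen_lt continuous_const Complex.continuous_im)).mem_nhds
          ⟨w, hw, hg0⟩
      have htend : Tendsto (fun ε : ℝ => (ε : ℂ)) (𝓝[>] 0) (𝓝 0) := by
        simpa using (Complex.continuous_ofReal.tendsto 0).mono_left nhdsWithin_le_nhds
      obtain ⟨ε, hε, w', hw', hwε⟩ := (eventually_mem_nhdsWithin.and (htend hnhds)).exists
      have := hreal w' hw' (by rw [hwε]; simp)
      rw [hwε] at this
      exact (Set.mem_Ioi.1 hε).ne' (Complex.ofReal_eq_zero.1 this)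
    by_contra hcon
    have hpos : 0 < (g z).im := lt_of_le_of_ne (not_lt.1 hcon) (hne z hz).symm
    obtain ⟨w, hw, hw0⟩ := isPreconnected_upperHalfPlane.intermediate_value hw₀ hz
      (Complex.continuous_im.comp_continuousOn hcont) ⟨hw₀n.le, hpos.le⟩
    exact hne w hw hw0

/-- Two pencils through the same polynomial `r`, in directions with nonnegative top coefficients,
span a triangle of real-rooted polynomials: on the upper half-plane `q₁ / r` and `q₂ / r` both have
nonpositive imaginary part. -/
lemma splits_convex_comb_of_splits_pencils {r q₁ q₂ : ℝ[X]} (hr : r.Monic)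
    (h₁ : q₁ = 0 ∨ q₁.natDegree + 1 = r.natDegree ∧ 0 < q₁.leadingCoeff)
    (h₂ : q₂ = 0 ∨ q₂.natDegree + 1 = r.natDegree ∧ 0 < q₂.leadingCoeff)
    (hs₁ : ∀ t : ℝ, (r + C t * q₁).Splits) (hs₂ : ∀ t : ℝ, (r + C t * q₂).Splits)
    {θ : ℝ} (h0 : 0 ≤ θ) (h1 : θ ≤ 1) :
    ((1 - θ) • (r + q₁) + θ • (r + q₂)).Splits := by
  refine splits_of_aeval_ne_zero fun z hz hzero => ?_
  have hr0 : aeval z r ≠ 0 :=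
    aeval_ne_zero_of_im_pos hr.ne_zero (by simpa using hs₁ 0) hz
  have key : ∀ q : ℝ[X], (q = 0 ∨ q.natDegree + 1 = r.natDegree ∧ 0 < q.leadingCoeff) →
      (∀ t : ℝ, (r + C t * q).Splits) →
      aeval z q / aeval z r = 0 ∨ (aeval z q / aeval z r).im < 0 := by
    rintro q (rfl | ⟨hd, hl⟩) hs
    · simp
    · exact Or.inr (im_div_neg_of_splits_pencil hr hd hl hs hz)
  have k₁ := key q₁ h₁ hs₁
  have k₂ := key q₂ h₂ hs₂
  have hsum : (1 - θ) * (aeval z q₁ / aeval z r) + θ * (aeval z q₂ / aeval z r) = -1 := by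
    rw [aeval_convex_comb, map_add, map_add] at hzero
    field_simp
    linear_combination hzero
  have him := congrArg Complex.im hsum
  have hcast : ((1 : ℂ) - θ) = ((1 - θ : ℝ) : ℂ) := by push_cast; rfl
  rw [hcast] at hsum him
  simp only [Complex.add_im, Complex.im_ofReal_mul, Complex.neg_im, Complex.one_im, neg_zero] at him
  have hre := congrArg Complex.re hsum
  simp only [Complex.add_re, Complex.re_ofReal_mul, Complex.neg_re, Complex.one_re] at hre
  have h1' : 0 ≤ 1 - θ := sub_nonneg.2 h1
  rcases h0.eq_or_lt with rfl | hθ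
  · rcases k₁ with k₁ | k₁
    · rw [k₁] at hre; simp at hre
    · linarith
  rcases h1'.eq_or_lt with hθ' | hθ'
  · rw [← hθ'] at him hre
    rcases k₂ with k₂ | k₂
    · rw [k₂] at hre; simp at hre
    · nlinarith
  · rcases k₁ with k₁ | k₁ <;> rcases k₂ with k₂ | k₂
    · rw [k₁, k₂] at hre; simp at hre
    · rw [k₁] at him; simp at him; rcases him with h | h <;> linarith
    · rw [k₂] at him; simp at him; rcases him with h | h <;> linarith
    · nlinarith

/-! ### Rank-one updates of symmetric matrices -/

variable {ι J : Type*} [Fintype ι] [DecidableEq ι] [Fintype J] [DecidableEq J]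

/-- The determinant is affine along rank-one updates: both sides expand the determinant of the
matrix bordered by `-c • u` and `v`, whose last column is affine in `c`. -/
lemma exists_det_add_smul_vecMulVec {R : Type*} [CommRing R] (M : Matrix ι ι R) (u v : ι → R) :
    ∃ x : R, ∀ c : R, (M + c • Matrix.vecMulVec u v).det = M.det + c * x := by
  let F : (ι → R) → Matrix (ι ⊕ Unit) (ι ⊕ Unit) R := fun w =>
    Matrix.fromBlocks M (Matrix.replicateCol Unit w) (Matrix.replicateRow Unit v) 1
  have hF : ∀ w : ι → R, (F w).det = (M - Matrix.vecMulVec w v).det := by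
    intro w
    simp only [F]
    rw [Matrix.det_fromBlocks_one₂₂, Matrix.vecMulVec_eq Unit]
  have hcol : ∀ c : R, F ((-c) • u) = (F 0).updateCol (Sum.inr ())
      ((-c) • Sum.elim u (0 : Unit → R) + Sum.elim (0 : ι → R) 1) := by
    intro c
    ext i j
    rcases i with i | i <;> rcases j with j | j <;> simp [F]
  have hzero : (F 0).updateCol (Sum.inr ()) (Sum.elim (0 : ι → R) 1) = F 0 := by
    ext i j
    rcases i with i | i <;> rcases j with j | j <;> simp [F]
  refine ⟨-((F 0).updateCol (Sum.inr ()) (Sum.elim u 0)).det, fun c => ?_⟩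
  have h := hF ((-c) • u)
  rw [hcol, Matrix.det_updateCol_add, Matrix.det_updateCol_smul, hzero, hF 0,
    Matrix.zero_vecMulVec, sub_zero, Matrix.smul_vecMulVec, neg_smul, sub_neg_eq_add] at h
  rw [← h]
  ring

lemma exists_charpoly_add_smul_vecMulVec (B : Matrix ι ι ℝ) (u : ι → ℝ) :
    ∃ q : ℝ[X], ∀ t : ℝ, (B + t • Matrix.vecMulVec u u).charpoly = B.charpoly + C t * q := by
  obtain ⟨x, hx⟩ := exists_det_add_smul_vecMulVec B.charmatrix (fun i => C (u i)) (fun i => C (u i))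
  refine ⟨-x, fun t => ?_⟩
  have : (B + t • Matrix.vecMulVec u u).charmatrix
      = B.charmatrix + (-C t) • Matrix.vecMulVec (fun i => C (u i)) (fun i => C (u i)) := by
    refine Matrix.ext fun i j => ?_
    simp only [Matrix.charmatrix_apply, Matrix.add_apply, Matrix.smul_apply, Matrix.vecMulVec_apply,
      smul_eq_mul, C_add, C_mul]
    ring
  simp only [Matrix.charpoly]
  rw [this, hx]
  ring

omit [Fintype ι] in
/-- Conjugating a symmetric matrix by a transposition changes it by a difference of two positive
semidefinite matrices of rank one. With `w = e_a - e_b`, the transposition is the reflection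
`1 - w wᵀ`, and `h = A w - (wᵀ A w / 2) w`. -/
lemma exists_submatrix_swap_add_vecMulVec {A : Matrix ι ι ℝ} (hA : A.IsSymm) {a b : ι}
    (hab : a ≠ b) :
    ∃ u v : ι → ℝ, A.submatrix (Equiv.swap a b) (Equiv.swap a b) + (1 / 2 : ℝ) •
      Matrix.vecMulVec v v = A + (1 / 2 : ℝ) • Matrix.vecMulVec u u := by
  let w : ι → ℝ := Pi.single a 1 - Pi.single b 1
  let h : ι → ℝ := fun i => A i a - A i b - (A a a - 2 * A a b + A b b) / 2 * w i
  have hw : ∀ (f : ι → ℝ) (i : ι), f (Equiv.swap a b i) = f i - w i * (f a - f b) := by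
    intro f i
    by_cases hia : i = a
    · subst hia; simp [w, hab]
    · by_cases hib : i = b
      · subst hib; simp [w, hia]
      · simp [w, hia, hib, Equiv.swap_apply_of_ne_of_ne]
  refine ⟨w - h, w + h, ?_⟩
  ext i j
  simp only [Matrix.add_apply, Matrix.submatrix_apply, Matrix.smul_apply, Matrix.vecMulVec_apply,
    Pi.add_apply, Pi.sub_apply, smul_eq_mul]
  rw [hw (fun j' => A (Equiv.swap a b i) j') j, hw (fun i' => A i' j) i, hw (fun i' => A i' a) i,
    hw (fun i' => A i' b) i]
  simp only [h]
  rw [hA.apply j a, hA.apply j b, hA.apply a b]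
  ring

/-! ### Admissible families of polynomials -/

/-- Simultaneous conjugation of a family of matrices by the permutation matrices of a family of
permutations. -/
def permute (g : J → Equiv.Perm ι) (A : J → Matrix ι ι ℝ) : J → Matrix ι ι ℝ :=
  fun j => (A j).submatrix (g j).symm (g j).symm

omit [Fintype ι] [DecidableEq ι] [Fintype J] [DecidableEq J] in
lemma permute_mul (g h : J → Equiv.Perm ι) (A : J → Matrix ι ι ℝ) :
    permute (g * h) A = permute g (permute h A) := rfl

omit [Fintype ι] [DecidableEq ι] [Fintype J] [DecidableEq J] in
lemma permute_one (A : J → Matrix ι ι ℝ) : permute (1 : J → Equiv.Perm ι) A = A := rfl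

omit [Fintype ι] [DecidableEq ι] [Fintype J] [DecidableEq J] in
lemma permute_isSymm {g : J → Equiv.Perm ι} {A : J → Matrix ι ι ℝ} (hA : ∀ j, (A j).IsSymm)
    (j : J) : (permute g A j).IsSymm := (hA j).submatrix _

omit [DecidableEq ι] [Fintype J] [DecidableEq J] in
lemma trace_permute (g : J → Equiv.Perm ι) (A : J → Matrix ι ι ℝ) (j : J) :
    (permute g A j).trace = (A j).trace :=
  Equiv.sum_comp (g j).symm fun i => A j i i

omit [Fintype ι] [DecidableEq ι] [Fintype J] in
lemma permute_update (g : J → Equiv.Perm ι) (A : J → Matrix ι ι ℝ) (j : J) (B : Matrix ι ι ℝ) :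
    permute g (Function.update A j B)
      = Function.update (permute g A) j (B.submatrix (g j).symm (g j).symm) := by
  ext1 i
  by_cases h : i = j
  · subst h; simp [permute]
  · simp [permute, h]

/-- A map from families of matrices to polynomials is admissible, relative to a set `Y` of families,
if it shares with `A ↦ charpoly (∑ j, A j)` the properties which survive averaging over random
transpositions: degree and two top coefficients, real-rootedness on families of symmetric matrices,
affine dependence on rank-one updates; and if on `Y` its second largest root is bounded below by
that of the characteristic polynomial of the sum of some member of `Y`. -/
structure IsAdmissible (Y : Set (J → Matrix ι ι ℝ)) (p : (J → Matrix ι ι ℝ) → ℝ[X]) : Prop where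
  monic : ∀ A, (p A).Monic
  natDegree_eq : ∀ A, (p A).natDegree = Fintype.card ι
  coeff_pred : ∀ A, (p A).coeff (Fintype.card ι - 1) = -∑ j, (A j).trace
  splits : ∀ A, (∀ j, (A j).IsSymm) → (p A).Splits
  affine : ∀ A j u, ∃ q : ℝ[X], ∀ t : ℝ,
    p (Function.update A j (A j + t • Matrix.vecMulVec u u)) = p A + C t * q
  exists_muTwo_le : ∀ A ∈ Y, ∃ A' ∈ Y, muTwo (∑ j, A' j).charpoly ≤ muTwo (p A)

lemma isAdmissible_charpoly [Nonempty ι] (Y : Set (J → Matrix ι ι ℝ)) :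
    IsAdmissible Y fun A => (∑ j, A j).charpoly where
  monic A := Matrix.charpoly_monic _
  natDegree_eq A := Matrix.charpoly_natDegree_eq_dim _
  coeff_pred A := by rw [← Matrix.trace_sum, Matrix.trace_eq_neg_charpoly_coeff, neg_neg]
  splits A hA := by
    refine Matrix.IsHermitian.splits_charpoly (A := ∑ j, A j) ?_
    rw [Matrix.IsHermitian, Matrix.conjTranspose_eq_transpose_of_trivial, Matrix.transpose_sum]
    exact Finset.sum_congr rfl fun j _ => hA j
  affine A j u := by
    obtain ⟨q, hq⟩ := exists_charpoly_add_smul_vecMulVec (∑ j, A j) u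
    refine ⟨q, fun t => ?_⟩
    rw [← hq, Finset.sum_update_of_mem (Finset.mem_univ j),
      ← Finset.add_sum_erase _ A (Finset.mem_univ j), Finset.sdiff_singleton_eq_erase]
    congr 1
    abel
  exists_muTwo_le A hA := ⟨A, hA, le_rfl⟩

/-- The images of the rank-one updates of a family of symmetric matrices lie on a pencil of
real-rooted polynomials, of the kind required by `splits_convex_comb_of_splits_pencils`. -/
lemma IsAdmissible.splits_pencil [Nonempty ι] {Y : Set (J → Matrix ι ι ℝ)}
    {p : (J → Matrix ι ι ℝ) → ℝ[X]} (hp : IsAdmissible Y p) {A : J → Matrix ι ι ℝ}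
    (hA : ∀ j, (A j).IsSymm) (j : J) (u : ι → ℝ) {r : ℝ[X]}
    (hr : r = p (Function.update A j (A j + (1 / 2 : ℝ) • Matrix.vecMulVec u u))) :
    (p A - r = 0 ∨ (p A - r).natDegree + 1 = r.natDegree ∧ 0 < (p A - r).leadingCoeff) ∧
      ∀ t : ℝ, (r + C t * (p A - r)).Splits := by
  have hcard : 0 < Fintype.card ι := Fintype.card_pos
  have hrd : r.natDegree = Fintype.card ι := hr ▸ hp.natDegree_eq _
  have hrm : r.Monic := hr ▸ hp.monic _
  constructor
  · have hcoeff : (p A - r).coeff (Fintype.card ι - 1) = 1 / 2 * ∑ i, u i * u i := by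
      rw [coeff_sub, hr, hp.coeff_pred, hp.coeff_pred,
        ← Finset.add_sum_erase _ (fun i => (A i).trace) (Finset.mem_univ j),
        ← Finset.add_sum_erase _ _ (Finset.mem_univ j)]
      have : ∑ i ∈ Finset.univ.erase j, (Function.update A j
          (A j + (1 / 2 : ℝ) • Matrix.vecMulVec u u) i).trace
          = ∑ i ∈ Finset.univ.erase j, (A i).trace :=
        Finset.sum_congr rfl fun i hi => by rw [Function.update_of_ne (Finset.ne_of_mem_erase hi)]
      rw [this, Function.update_self, Matrix.trace_add, Matrix.trace_smul, Matrix.trace_vecMulVec,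
        dotProduct, smul_eq_mul]
      ring
    by_cases hu : u = 0
    · left
      rw [hr, hu]
      simp
    · right
      have hpos : 0 < (p A - r).coeff (Fintype.card ι - 1) := by
        rw [hcoeff]
        obtain ⟨i, hi⟩ := Function.ne_iff.1 hu
        have := Finset.sum_pos' (s := Finset.univ) (f := fun i => u i * u i)
          (fun i _ => mul_self_nonneg _) ⟨i, Finset.mem_univ i, mul_self_pos.2 hi⟩
        linarith
      have hlt : (p A - r).natDegree < Fintype.card ι := by
        exact IsMonicOfDegree.natDegree_sub_lt hcard.ne' ⟨hp.natDegree_eq A, hp.monic A⟩ ⟨hrd, hrm⟩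
      have hd : (p A - r).natDegree = Fintype.card ι - 1 :=
        le_antisymm (by omega) (le_natDegree_of_ne_zero hpos.ne')
      refine ⟨by omega, ?_⟩
      rwa [leadingCoeff, hd]
  · intro t
    obtain ⟨q, hq⟩ := hp.affine A j u
    have : r + C t * (p A - r)
        = p (Function.update A j (A j + (1 / 2 - t * (1 / 2)) • Matrix.vecMulVec u u)) := by
      rw [hr, hq, hq, C_sub, C_mul]
      ring
    rw [this]
    refine hp.splits _ fun i => ?_
    by_cases h : i = j
    · subst h
      rw [Function.update_self]
      refine (hA i).add (Matrix.IsSymm.smul ?_ _)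
      rw [Matrix.IsSymm, Matrix.transpose_vecMulVec]
    · rw [Function.update_of_ne h]
      exact hA i

/-- The average of `p` over a random simultaneous permutation which is `g` with probability `θ` and
trivial otherwise. -/
noncomputable def lazyAverage (θ : ℝ) (g : J → Equiv.Perm ι) (p : (J → Matrix ι ι ℝ) → ℝ[X]) :
    (J → Matrix ι ι ℝ) → ℝ[X] :=
  fun A => (1 - θ) • p A + θ • p (permute g A)

lemma IsAdmissible.splits_convex_comb_swap [Nonempty ι] {Y : Set (J → Matrix ι ι ℝ)}
    {p : (J → Matrix ι ι ℝ) → ℝ[X]} (hp : IsAdmissible Y p) {A : J → Matrix ι ι ℝ}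
    (hA : ∀ j, (A j).IsSymm) (j : J) {a b : ι} (hab : a ≠ b) {θ : ℝ} (h0 : 0 ≤ θ) (h1 : θ ≤ 1) :
    ((1 - θ) • p A + θ • p (permute (Pi.mulSingle j (Equiv.swap a b)) A)).Splits := by
  obtain ⟨u, v, huv⟩ := exists_submatrix_swap_add_vecMulVec (hA j) hab
  set A' := permute (Pi.mulSingle j (Equiv.swap a b)) A with hA'
  have hj : A' j = (A j).submatrix (Equiv.swap a b) (Equiv.swap a b) := by
    simp [hA', permute]
  have hupd : Function.update A' j (A' j + (1 / 2 : ℝ) • Matrix.vecMulVec v v)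
      = Function.update A j (A j + (1 / 2 : ℝ) • Matrix.vecMulVec u u) := by
    ext1 i
    by_cases h : i = j
    · subst h; rw [Function.update_self, Function.update_self, hj, huv]
    · rw [Function.update_of_ne h, Function.update_of_ne h]
      simp only [hA', permute, Pi.mulSingle_eq_of_ne h]
      rfl
  set r := p (Function.update A j (A j + (1 / 2 : ℝ) • Matrix.vecMulVec u u)) with hr
  have k₁ := hp.splits_pencil hA j u hr
  have k₂ := hp.splits_pencil (A := A') (permute_isSymm hA) j v (r := r) (by rw [hupd])
  have := splits_convex_comb_of_splits_pencils (hr ▸ hp.monic _) k₁.1 k₂.1 k₁.2 k₂.2 h0 h1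
  simpa using this

/-- Admissibility survives averaging over a random transposition of one of the matrices. -/
lemma IsAdmissible.lazyAverage_swap (hcard : 2 ≤ Fintype.card ι) {Y : Set (J → Matrix ι ι ℝ)}
    (hY : ∀ A ∈ Y, ∀ j, (A j).IsSymm) {p : (J → Matrix ι ι ℝ) → ℝ[X]} (hp : IsAdmissible Y p)
    (j : J) {a b : ι} (hab : a ≠ b)
    (hmaps : Set.MapsTo (permute (Pi.mulSingle j (Equiv.swap a b))) Y Y)
    {θ : ℝ} (h0 : 0 ≤ θ) (h1 : θ ≤ 1) :
    IsAdmissible Y (lazyAverage θ (Pi.mulSingle j (Equiv.swap a b)) p) := by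
  have : Nonempty ι := ⟨a⟩
  set g : J → Equiv.Perm ι := Pi.mulSingle j (Equiv.swap a b) with hg
  have hdeg : ∀ A, (p A).natDegree = (p (permute g A)).natDegree := fun A => by
    rw [hp.natDegree_eq, hp.natDegree_eq]
  refine ⟨fun A => (natDegree_convex_comb (hp.monic _) (hp.monic _) (hdeg A) θ).1, fun A =>
    (natDegree_convex_comb (hp.monic _) (hp.monic _) (hdeg A) θ).2.trans (hp.natDegree_eq A),
    fun A => ?_, fun A hA => hp.splits_convex_comb_swap hA j hab h0 h1, fun A i u => ?_,
    fun A hA => ?_⟩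
  · simp only [lazyAverage, coeff_add, coeff_smul, hp.coeff_pred, trace_permute, smul_eq_mul]
    ring
  · obtain ⟨q₁, hq₁⟩ := hp.affine A i u
    obtain ⟨q₂, hq₂⟩ := hp.affine (permute g A) i (u ∘ (g i).symm)
    refine ⟨(1 - θ) • q₁ + θ • q₂, fun t => ?_⟩
    have : (A i + t • Matrix.vecMulVec u u).submatrix (g i).symm (g i).symm
        = permute g A i + t • Matrix.vecMulVec (u ∘ (g i).symm) (u ∘ (g i).symm) := rfl
    simp only [lazyAverage]
    rw [permute_update, this, hq₁, hq₂]
    simp only [smul_add, mul_add, smul_eq_C_mul]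
    ring
  · have hsym := hY A hA
    rcases muTwo_le_muTwo_convex_comb (hp.monic A) (hp.monic (permute g A)) (hdeg A)
      (fun η hη0 hη1 => hp.splits_convex_comb_swap hsym j hab hη0 hη1)
      (by rwa [hp.natDegree_eq]) h0 h1 with h | h
    · obtain ⟨A', hA', hle⟩ := hp.exists_muTwo_le A hA
      exact ⟨A', hA', hle.trans h⟩
    · obtain ⟨A', hA', hle⟩ := hp.exists_muTwo_le _ (hmaps hA)
      exact ⟨A', hA', hle.trans h⟩

/-! ### Averages over groups of permutations -/

section Averages

variable {ι J : Type*} [Fintype ι] [DecidableEq ι] [Fintype J] [DecidableEq J]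

/-- The average of `p` over a uniformly random member of a finite family of simultaneous
permutations. -/
noncomputable def average {K : Type*} [Fintype K] (φ : K → J → Equiv.Perm ι)
    (p : (J → Matrix ι ι ℝ) → ℝ[X]) : (J → Matrix ι ι ℝ) → ℝ[X] :=
  fun A => (Fintype.card K : ℝ)⁻¹ • ∑ k, p (permute (φ k) A)

/-- A finite family of simultaneous permutations preserves admissibility if averaging over it
does. -/
def PreservesAdmissible (Y : Set (J → Matrix ι ι ℝ)) {K : Type*} [Fintype K]
    (φ : K → J → Equiv.Perm ι) : Prop :=
  ∀ p, IsAdmissible Y p → IsAdmissible Y (average φ p)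

variable {Y : Set (J → Matrix ι ι ℝ)}

lemma PreservesAdmissible.of_equiv {K L : Type*} [Fintype K] [Fintype L] (e : K ≃ L)
    {φ : L → J → Equiv.Perm ι} (h : PreservesAdmissible Y (φ ∘ e)) : PreservesAdmissible Y φ := by
  intro p hp
  have : average φ p = average (φ ∘ e) p := by
    funext A
    simp only [average, Fintype.card_congr e, Function.comp_apply]
    rw [e.sum_comp fun l => p (permute (φ l) A)]
  rw [this]
  exact h p hp

lemma PreservesAdmissible.mul {K L : Type*} [Fintype K] [Fintype L] {φ : K → J → Equiv.Perm ι}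
    {ψ : L → J → Equiv.Perm ι} (hφ : PreservesAdmissible Y φ) (hψ : PreservesAdmissible Y ψ) :
    PreservesAdmissible Y fun x : K × L => φ x.1 * ψ x.2 := by
  intro p hp
  have : average (fun x : K × L => φ x.1 * ψ x.2) p = average ψ (average φ p) := by
    funext A
    simp only [average, permute_mul, Fintype.card_prod, Nat.cast_mul, mul_inv, Fintype.sum_prod_type]
    rw [Finset.sum_comm, ← Finset.smul_sum, smul_smul, mul_comm]
  rw [this]
  exact hψ _ (hφ _ hp)

lemma PreservesAdmissible.of_subsingleton {K : Type*} [Fintype K] [Subsingleton K] [Group K]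
    (φ : K →* (J → Equiv.Perm ι)) : PreservesAdmissible Y φ := by
  intro p hp
  have : average φ p = p := by
    funext A
    have hK : Fintype.card K = 1 := Fintype.card_eq_one_iff.2 ⟨1, fun k => Subsingleton.elim _ _⟩
    simp [average, Fintype.sum_subsingleton _ (1 : K), hK, permute_one]
  rwa [this]

lemma PreservesAdmissible.pi {K : Type*} [Group K] [Fintype K] (d : ℕ)
    (φ : (Fin d → K) →* (J → Equiv.Perm ι))
    (h : ∀ i, PreservesAdmissible Y (φ.comp (MonoidHom.mulSingle (fun _ => K) i))) :
    PreservesAdmissible Y φ := by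
  induction d with
  | zero => exact .of_subsingleton φ
  | succ d ih =>
    let tail : (Fin d → K) →* (Fin (d + 1) → K) :=
      { toFun := fun f => Fin.cons 1 f
        map_one' := by
          ext1 i
          refine Fin.cases ?_ (fun i => ?_) i <;> simp
        map_mul' := fun f g => by
          ext1 i
          refine Fin.cases ?_ (fun i => ?_) i <;> simp }
    have htail : PreservesAdmissible Y (φ.comp tail) := by
      refine ih _ fun i => ?_
      have : (φ.comp tail).comp (MonoidHom.mulSingle (fun _ => K) i)
          = φ.comp (MonoidHom.mulSingle (fun _ => K) i.succ) := by
        ext1 k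
        simp only [MonoidHom.comp_apply]
        congr 1
        ext1 l
        refine Fin.cases ?_ (fun l => ?_) l
        · simp [tail]
        · by_cases hl : l = i
          · subst hl; simp [tail]
          · simp [tail, hl, Pi.mulSingle_eq_of_ne]
      rw [this]
      exact h _
    refine .of_equiv (Fin.consEquiv fun _ => K) ?_
    have : (φ ∘ (Fin.consEquiv fun _ => K) : K × (Fin d → K) → J → Equiv.Perm ι)
        = fun x => φ.comp (MonoidHom.mulSingle (fun _ => K) 0) x.1 * φ.comp tail x.2 := by
      funext x
      simp only [Function.comp_apply, MonoidHom.comp_apply, ← map_mul]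
      congr 1
      ext1 l
      refine Fin.cases ?_ (fun l => ?_) l <;> simp [tail, Fin.consEquiv]
    rw [this]
    exact (h 0).mul htail

end Averages

/-! ### Uniform permutations from random transpositions -/

/-- Adjoining a fixed point to a permutation, as a homomorphism. -/
def optionCongrHom (α : Type*) : Equiv.Perm α →* Equiv.Perm (Option α) where
  toFun σ := σ.optionCongr
  map_one' := Equiv.optionCongr_refl
  map_mul' σ τ := Equiv.ext fun x => by cases x <;> rfl

/-- A uniform permutation of `Option α` is the product of two uniform permutations of `α` with,
between them, the transposition of `none` and `some b`, performed with probability `m / (m + 1)`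
where `m` is the size of `α`. Moving the left factor across that transposition turns it into the
transposition of `none` and a uniform element of `α`. -/
lemma sum_perm_option {α V : Type*} [Fintype α] [DecidableEq α] [AddCommGroup V] [Module ℝ V]
    (b : α) (F : Equiv.Perm (Option α) → V) :
    (Fintype.card (Equiv.Perm (Option α)) : ℝ)⁻¹ • ∑ k, F k
      = (Fintype.card (Equiv.Perm α) : ℝ)⁻¹ • ∑ h : Equiv.Perm α,
        ((1 - (Fintype.card α : ℝ) / (Fintype.card α + 1)) •
          ((Fintype.card (Equiv.Perm α) : ℝ)⁻¹ • ∑ h' : Equiv.Perm α,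
            F (optionCongrHom α h' * optionCongrHom α h)) +
        ((Fintype.card α : ℝ) / (Fintype.card α + 1)) •
          ((Fintype.card (Equiv.Perm α) : ℝ)⁻¹ • ∑ h' : Equiv.Perm α,
            F (optionCongrHom α h' * Equiv.swap none (some b) * optionCongrHom α h))) := by
  set H := optionCongrHom α with hH
  set m : ℝ := (Fintype.card α : ℝ) with hm
  set c : ℝ := (Fintype.card (Equiv.Perm α) : ℝ) with hc
  have hm0 : m ≠ 0 := by
    have : Nonempty α := ⟨b⟩
    exact Nat.cast_ne_zero.2 Fintype.card_ne_zero
  have hm1 : m + 1 ≠ 0 := by positivity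
  have hc0 : c ≠ 0 := Nat.cast_ne_zero.2 Fintype.card_ne_zero
  have hcard : (Fintype.card (Equiv.Perm (Option α)) : ℝ) = (m + 1) * c := by
    rw [Fintype.card_congr Equiv.Perm.decomposeOption, Fintype.card_prod, Fintype.card_option]
    push_cast
    rfl
  let G : α → V := fun a => ∑ h, F (Equiv.swap none (some a) * H h)
  have hsum : ∑ k, F k = ∑ h, F (H h) + ∑ a, G a := by
    rw [← Equiv.Perm.decomposeOption.symm.sum_comp, Fintype.sum_prod_type, Fintype.sum_option]
    congr 1
    refine Finset.sum_congr rfl fun h _ => ?_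
    congr 1
    exact Equiv.ext fun x => by simp [hH, optionCongrHom]
  have h1 : ∀ h' : Equiv.Perm α, ∑ h, F (H h' * H h) = ∑ h, F (H h) := fun h' => by
    simp only [← map_mul]
    exact Equiv.sum_comp (Equiv.mulLeft h') fun h => F (H h)
  have h2 : ∀ h' : Equiv.Perm α, ∑ h, F (H h' * Equiv.swap none (some b) * H h) = G (h' b) := by
    intro h'
    have hswap : H h' * Equiv.swap none (some b) = Equiv.swap none (some (h' b)) * H h' := by
      have := Equiv.mul_swap_eq_swap_mul (H h') none (some b)
      simpa [hH, optionCongrHom] using this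
    simp only [hswap, mul_assoc, ← map_mul, G]
    exact Equiv.sum_comp (Equiv.mulLeft h') fun h => F (Equiv.swap none (some (h' b)) * H h)
  have h3 : m • ∑ h' : Equiv.Perm α, G (h' b) = c • ∑ a, G a := by
    have hb : ∀ a, ∑ h' : Equiv.Perm α, G (h' a) = ∑ h' : Equiv.Perm α, G (h' b) := fun a => by
      rw [← Equiv.sum_comp (Equiv.mulRight (Equiv.swap a b)) fun h' : Equiv.Perm α => G (h' b)]
      simp
    have e1 : ∑ a, ∑ h' : Equiv.Perm α, G (h' a) = m • ∑ h' : Equiv.Perm α, G (h' b) := by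
      simp [hb, hm, Nat.cast_smul_eq_nsmul]
    have e2 : ∑ h' : Equiv.Perm α, ∑ a, G (h' a) = c • ∑ a, G a := by
      simp [fun h' : Equiv.Perm α => Equiv.sum_comp h' G, hc, Nat.cast_smul_eq_nsmul]
    rw [← e1, Finset.sum_comm, e2]
  have h3' : ∑ h' : Equiv.Perm α, G (h' b) = (m⁻¹ * c) • ∑ a, G a := by
    rw [mul_smul, ← h3, smul_smul, inv_mul_cancel₀ hm0, one_smul]
  have h4 : ∑ _h' : Equiv.Perm α, ∑ h, F (H h) = c • ∑ h, F (H h) := by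
    simp [hc, Nat.cast_smul_eq_nsmul]
  rw [Finset.sum_add_distrib, ← Finset.smul_sum, ← Finset.smul_sum, ← Finset.smul_sum,
    ← Finset.smul_sum, Finset.sum_comm, Finset.sum_comm (f := fun h h' =>
      F (H h' * Equiv.swap none (some b) * H h))]
  simp only [h1, h2]
  rw [h3', h4, hcard, hsum]
  simp only [smul_add, smul_smul]
  congr 2
  · field_simp
    ring
  · field_simp

section Uniform

variable {ι J : Type*} [Fintype ι] [DecidableEq ι] [Fintype J] [DecidableEq J]
  {Y : Set (J → Matrix ι ι ℝ)}

/-- Averaging over a full symmetric group, acting so that its transpositions act as transpositions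
on one of the matrices, preserves admissibility. -/
lemma preservesAdmissible_perm (hcard : 2 ≤ Fintype.card ι) (hY : ∀ A ∈ Y, ∀ j, (A j).IsSymm)
    (α : Type) [Fintype α] : ∀ [DecidableEq α] (φ : Equiv.Perm α →* (J → Equiv.Perm ι)),
    (∀ σ, Set.MapsTo (permute (φ σ)) Y Y) →
    (∀ a b, a ≠ b → ∃ j x y, x ≠ y ∧ φ (Equiv.swap a b) =
      (Pi.mulSingle j (Equiv.swap x y) : J → Equiv.Perm ι)) →
    PreservesAdmissible Y φ := by
  refine Fintype.induction_empty_option (P := fun α _ => ∀ [DecidableEq α]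
    (φ : Equiv.Perm α →* (J → Equiv.Perm ι)), (∀ σ, Set.MapsTo (permute (φ σ)) Y Y) →
    (∀ a b, a ≠ b → ∃ j x y, x ≠ y ∧ φ (Equiv.swap a b) =
      (Pi.mulSingle j (Equiv.swap x y) : J → Equiv.Perm ι)) →
    PreservesAdmissible Y φ) ?_ ?_ ?_ α
  · intro α β _ e ih _ φ hφ hswap
    let _ : DecidableEq α := Classical.decEq α
    let _ : Fintype α := Fintype.ofEquiv β e.symm
    let ψ : Equiv.Perm α →* (J → Equiv.Perm ι) := φ.comp e.permCongrHom.toMonoidHom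
    refine .of_equiv e.permCongr (ih ψ (fun σ => hφ _) fun a b hab => ?_)
    obtain ⟨j, x, y, hxy, h⟩ := hswap (e a) (e b) (e.injective.ne hab)
    refine ⟨j, x, y, hxy, ?_⟩
    rw [← h]
    show φ (e.permCongr (Equiv.swap a b)) = _
    congr 1
    exact Equiv.ext fun z => by simp [Equiv.swap_apply_def, Equiv.symm_apply_eq, apply_ite e]
  · intro _ φ _ _
    exact .of_subsingleton φ
  · intro α _ ih inst φ hφ hswap
    let _ : DecidableEq α := Classical.decEq α
    obtain rfl : inst = Option.instDecidableEq := Subsingleton.elim _ _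
    rcases isEmpty_or_nonempty α with hα | ⟨⟨b⟩⟩
    · have : Subsingleton (Equiv.Perm (Option α)) := inferInstance
      exact .of_subsingleton φ
    have hψ : PreservesAdmissible Y (φ.comp (optionCongrHom α)) := by
      refine ih _ (fun σ => hφ _) fun a c hac => ?_
      obtain ⟨j, x, y, hxy, h⟩ := hswap (some a) (some c) (by simpa using hac)
      refine ⟨j, x, y, hxy, ?_⟩
      rw [← h]
      show φ (Equiv.optionCongr _) = _
      rw [Equiv.optionCongr_swap]
    intro p hp
    obtain ⟨j, x, y, hxy, h⟩ := hswap none (some b) (by simp)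
    set θ : ℝ := (Fintype.card α : ℝ) / (Fintype.card α + 1) with hθ
    have h0 : 0 ≤ θ := by positivity
    have h1 : θ ≤ 1 := by rw [hθ, div_le_one (by positivity)]; linarith
    have hcomb := hψ _ ((hψ p hp).lazyAverage_swap hcard hY j hxy (h ▸ hφ _) h0 h1)
    convert hcomb using 1
    funext A
    have := sum_perm_option b fun k => p (permute (φ k) A)
    rw [← hθ] at this
    simp only [average, lazyAverage, ← h, MonoidHom.comp_apply, ← permute_mul, ← map_mul]
    simpa only [mul_assoc, ← map_mul] using this

end Uniform

/-! ### Unions of random claw matchings -/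

/-- The simultaneous permutations of the vertex set `(Fin k × Fin n) ⊕ Fin n` described by a sample,
as a homomorphism. -/
def sampleHom (k n d : ℕ) :
    Sample k n d →* (Fin d → Equiv.Perm ((Fin k × Fin n) ⊕ Fin n)) where
  toFun ω i := Equiv.Perm.sumCongrHom _ _ (ω i)
  map_one' := funext fun _ => map_one _
  map_mul' _ _ := funext fun _ => map_mul _ _ _

/-- The conjugates of the claw matrix by the permutations of a sample. -/
def clawOrbit (k n d : ℕ) :
    Set (Fin d → Matrix ((Fin k × Fin n) ⊕ Fin n) ((Fin k × Fin n) ⊕ Fin n) ℝ) :=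
  Set.range fun ω : Sample k n d => permute (sampleHom k n d ω) fun _ => clawMatrix k n

lemma mapsTo_permute_clawOrbit (k n d : ℕ) (ω : Sample k n d) :
    Set.MapsTo (permute (sampleHom k n d ω)) (clawOrbit k n d) (clawOrbit k n d) := by
  rintro _ ⟨ω', rfl⟩
  exact ⟨ω * ω', by simp only [map_mul, permute_mul]⟩

lemma isSymm_of_mem_clawOrbit {k n d : ℕ} :
    ∀ A ∈ clawOrbit k n d, ∀ j, (A j).IsSymm := by
  rintro _ ⟨ω, rfl⟩
  exact permute_isSymm fun _ => by
    simpa [Matrix.IsSymm, Matrix.IsHermitian, Matrix.conjTranspose_eq_transpose_of_trivial]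
      using clawMatrix_isHermitian k n

lemma preservesAdmissible_sampleHom {k n : ℕ} (hk : 0 < k) (hn : 0 < n) (d : ℕ) :
    PreservesAdmissible (clawOrbit k n d) (sampleHom k n d) := by
  have hcard : 2 ≤ Fintype.card ((Fin k × Fin n) ⊕ Fin n) := one_lt_card_index hk hn
  refine .pi d _ fun i => ?_
  set ψ := (sampleHom k n d).comp (MonoidHom.mulSingle (fun _ => _) i) with hψ
  have hsingle : ∀ σ τ, ψ (σ, τ) = Pi.mulSingle i (Equiv.Perm.sumCongr σ τ) := by
    intro σ τ
    ext1 j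
    by_cases h : j = i
    · subst h; simp [hψ, sampleHom]
    · simp [hψ, sampleHom, Pi.mulSingle_eq_of_ne h]
  have hmul : (ψ : _ → _)
      = fun x => ψ.comp (MonoidHom.inl _ _) x.1 * ψ.comp (MonoidHom.inr _ _) x.2 := by
    funext x
    simp [← map_mul]
  rw [hmul]
  refine .mul (preservesAdmissible_perm hcard isSymm_of_mem_clawOrbit _ _
    (fun σ => mapsTo_permute_clawOrbit k n d _) fun a b hab => ?_)
    (preservesAdmissible_perm hcard isSymm_of_mem_clawOrbit _ _
    (fun σ => mapsTo_permute_clawOrbit k n d _) fun a b hab => ?_)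
  · refine ⟨i, Sum.inl a, Sum.inl b, by simpa using hab, ?_⟩
    rw [MonoidHom.comp_apply, MonoidHom.inl_apply, hsingle, Equiv.Perm.sumCongr_swap_one]
  · refine ⟨i, Sum.inr a, Sum.inr b, by simpa using hab, ?_⟩
    rw [MonoidHom.comp_apply, MonoidHom.inr_apply, hsingle, Equiv.Perm.sumCongr_one_swap]

lemma permSum_mul_mul_transpose {k n : ℕ} (σ : Equiv.Perm (Fin k × Fin n)) (τ : Equiv.Perm (Fin n))
    (A : Matrix ((Fin k × Fin n) ⊕ Fin n) ((Fin k × Fin n) ⊕ Fin n) ℝ) :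
    permSum σ τ * A * (permSum σ τ)ᵀ
      = A.submatrix (Equiv.Perm.sumCongr σ τ) (Equiv.Perm.sumCongr σ τ) := by
  have h : permSum σ τ = (Equiv.Perm.sumCongr σ τ).permMatrix ℝ := by
    ext i j
    rcases i with i | i <;> rcases j with j | j <;>
      simp [permSum, PEquiv.toMatrix_apply]
  rw [h, Matrix.transpose_permMatrix, PEquiv.toMatrix_toPEquiv_mul, PEquiv.mul_toMatrix_toPEquiv]
  rfl

lemma unionMatrix_inv {k n d : ℕ} (ω : Sample k n d) :
    unionMatrix ω⁻¹ = ∑ i, permute (sampleHom k n d ω) (fun _ => clawMatrix k n) i := by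
  refine Finset.sum_congr rfl fun i _ => ?_
  rw [permSum_mul_mul_transpose]
  rfl

lemma expectedCharpoly_eq_average (k n d : ℕ) :
    expectedCharpoly k n d
      = average (sampleHom k n d) (fun A => (∑ i, A i).charpoly) fun _ => clawMatrix k n := by
  simp only [expectedCharpoly, expectedPoly, law, average, ← unionMatrix_inv]
  have hinv : ∑ ω : Sample k n d, (unionMatrix ω⁻¹).charpoly
      = ∑ ω : Sample k n d, (unionMatrix ω).charpoly :=
    Equiv.sum_comp (Equiv.inv (Sample k n d)) fun ω => (unionMatrix ω).charpoly
  rw [hinv, Finset.smul_sum]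
  exact Finset.sum_congr rfl fun ω _ => by simp

lemma lambdaTwo_eq_muTwo_charpoly {ι : Type*} [Fintype ι] [DecidableEq ι] {A : Matrix ι ι ℝ}
    (hA : A.IsHermitian) (hι : 1 < Fintype.card ι) : lambdaTwo hA hι = muTwo A.charpoly := by
  have h := hA.sort_roots_charpoly_eq_eigenvalues₀
  have hre : (RCLike.re : ℝ → ℝ) = id := rfl
  rw [hre, Multiset.map_id] at h
  rw [lambdaTwo, muTwo, h, List.getD_eq_getElem _ _ (by simpa using hι), List.getElem_ofFn]

end ClawMatching

theorem proposition1p3 (k n d : ℕ) (hk : 0 < k) (hn : 0 < n) :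
    ((ClawMatching.expectedCharpoly k n d).natDegree = (k + 1) * n ∧
      (ClawMatching.expectedCharpoly k n d).Splits) ∧
    0 < (ClawMatching.law k n d).toOuterMeasure
      {ω | ClawMatching.lambdaTwo (ClawMatching.unionMatrix_isHermitian ω)
          (ClawMatching.one_lt_card_index hk hn)
        ≤ ClawMatching.muTwo (ClawMatching.expectedCharpoly k n d)} := by
  have : Nonempty ((Fin k × Fin n) ⊕ Fin n) := ⟨Sum.inr ⟨0, hn⟩⟩
  have hadm := ClawMatching.preservesAdmissible_sampleHom hk hn d _
    (ClawMatching.isAdmissible_charpoly (ClawMatching.clawOrbit k n d))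
  rw [ClawMatching.expectedCharpoly_eq_average]
  have hmem : (fun _ => ClawMatching.clawMatrix k n) ∈ ClawMatching.clawOrbit k n d :=
    ⟨1, by simp only [map_one, ClawMatching.permute_one]⟩
  refine ⟨⟨?_, hadm.splits _ (ClawMatching.isSymm_of_mem_clawOrbit _ hmem)⟩, ?_⟩
  · rw [hadm.natDegree_eq]
    simp only [Fintype.card_sum, Fintype.card_prod, Fintype.card_fin]
    ring
  · obtain ⟨_, ⟨ω, rfl⟩, hle⟩ := hadm.exists_muTwo_le _ hmem
    rw [pos_iff_ne_zero, ne_eq, PMF.toOuterMeasure_apply_eq_zero_iff, Set.not_disjoint_iff]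
    refine ⟨ω⁻¹, by simp [ClawMatching.law], ?_⟩
    rw [Set.mem_ofPred_eq, ClawMatching.lambdaTwo_eq_muTwo_charpoly, ClawMatching.unionMatrix_inv]
    exact hle
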